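/- Let $n,m$ be positive integers, not both equal to $1$, and let $\Theta$ be a real $n\times m$ matrix with transpose ${}^{t}\Theta$. Let $|\cdot|_\infty$ denote the sup-norm. Let $\beta(\Theta)\in[-\infty,+\infty]$ be the supremum of the real numbers $\gamma$ for which there are infinitely many pairs $(x,y)\in\mathbb Z^m\times\mathbb Z^n$ with $x\neq 0$ and $|\Theta x-y|_\infty\le |x|_\infty^{-\gamma}$. Let $\alpha(\Theta)$ be the supremum of the real numbers $\gamma$ such that for every sufficiently large real $t$ there are $x\in\mathbb Z^m$, $y\in\mathbb Z^n$ with $0<|x|_\infty\le t$ and $|\Theta x-y|_\infty\le t^{-\gamma}$. Define $\beta({}^{t}\Theta)$ in the same way for the $m\times n$ matrix ${}^{t}\Theta$. Then: 1. $$\beta({}^{t}\Theta)\ \ge\ \frac{n\beta(\Theta)+n-1}{(m-1)\beta(\Theta)+m}.$$ 2. If $\alpha(\Theta)<\infty$, then $$\beta({}^{t}\Theta)\ \ge\ \frac{(n-1)(1+\beta(\Theta))-(1-\alpha(\Theta))}{(m-1)(1+\beta(\Theta))+(1-\alpha(\Theta))}.$$ 3. If the group $\{x\in\mathbb Z^m:\Theta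 x\in\mathbb Z^n\}$ does not have rank exactly $1$ (which is automatic when $\alpha(\Theta)<\infty$, since then this group is $\{0\}$), then $$\beta({}^{t}\Theta)\ \ge\ \frac{(n-1)(1+\beta(\Theta)^{-1})-(\alpha(\Theta)^{-1}-1)}{(m-1)(1+\beta(\Theta)^{-1})+(\alpha(\Theta)^{-1}-1)}.$$ Here the exponents may be $+\infty$. When $\beta(\Theta)=+\infty$, the right-hand side of 1 is read as $\frac{n}{m-1}$ and that of 2 as $\frac{n-1}{m-1}$ (their limits as $\beta(\Theta)\to+\infty$); in 3 one puts $(+\infty)^{-1}=0$; and a fraction with zero denominator is read as $+\infty$. -/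

import Mathlib

noncomputable section

namespace Diophantine

/-- The error vector `Θ x - y` for integer vectors `x` and `y`. The norm on `Fin n → ℝ` and on
`Fin m → ℤ` is the sup-norm. -/
def errorVec {n m : ℕ} (Θ : Matrix (Fin n) (Fin m) ℝ) (x : Fin m → ℤ) (y : Fin n → ℤ) :
    Fin n → ℝ :=
  Θ.mulVec (fun j => (x j : ℝ)) - fun i => (y i : ℝ)

/-- The individual Diophantine exponent `β(Θ)`: the supremum, in the extended reals, of the real
numbers `γ` such that `|Θ x - y| ≤ |x| ^ (-γ)` for infinitely many pairs of integer vectors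
`(x, y)` with `x ≠ 0`. -/
def individualExponent {n m : ℕ} (Θ : Matrix (Fin n) (Fin m) ℝ) : EReal :=
  sSup {g : EReal | ∃ γ : ℝ, g = (γ : EReal) ∧
    {p : (Fin m → ℤ) × (Fin n → ℤ) |
      p.1 ≠ 0 ∧ ‖errorVec Θ p.1 p.2‖ ≤ ‖p.1‖ ^ (-γ)}.Infinite}

/-- The uniform Diophantine exponent `α(Θ)`: the supremum, in the extended reals, of the real
numbers `γ` such that for every sufficiently large `t` there are integer vectors `x`, `y` with
`0 < |x| ≤ t` and `|Θ x - y| ≤ t ^ (-γ)`. -/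
def uniformExponent {n m : ℕ} (Θ : Matrix (Fin n) (Fin m) ℝ) : EReal :=
  sSup {g : EReal | ∃ γ : ℝ, g = (γ : EReal) ∧
    ∀ᶠ t : ℝ in Filter.atTop, ∃ (x : Fin m → ℤ) (y : Fin n → ℤ),
      0 < ‖x‖ ∧ ‖x‖ ≤ t ∧ ‖errorVec Θ x y‖ ≤ t ^ (-γ)}

/-- The integer vectors `x` for which `Θ x = y` has an integer solution `y`. This is a subgroup
of `ℤ ^ m`. -/
def exactSolutions {n m : ℕ} (Θ : Matrix (Fin n) (Fin m) ℝ) : Set (Fin m → ℤ) :=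
  {x | ∃ y : Fin n → ℤ, errorVec Θ x y = 0}

/-- The quotient `p / q` as an extended real, equal to `+∞` when the denominator vanishes
(it is used for expressions whose numerator is positive whenever the denominator is `0`). -/
def quot (p q : ℝ) : EReal :=
  if q = 0 then ⊤ else ((p / q : ℝ) : EReal)

/-- `(n β + n - 1) / ((m - 1) β + m)`, read as its limit `n / (m - 1)` at `β = +∞`. -/
def bound₁ (n m : ℕ) (β : EReal) : EReal :=
  if β = ⊤ then quot (n : ℝ) ((m : ℝ) - 1)
  else quot ((n : ℝ) * β.toReal + (n : ℝ) - 1) (((m : ℝ) - 1) * β.toReal + (m : ℝ))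

/-- `((n - 1) (1 + β) - (1 - α)) / ((m - 1) (1 + β) + (1 - α))` for finite `α`, read as its
limit `(n - 1) / (m - 1)` at `β = +∞`. -/
def bound₂ (n m : ℕ) (α : ℝ) (β : EReal) : EReal :=
  if β = ⊤ then quot ((n : ℝ) - 1) ((m : ℝ) - 1)
  else quot (((n : ℝ) - 1) * (1 + β.toReal) - (1 - α))
    (((m : ℝ) - 1) * (1 + β.toReal) + (1 - α))

/-- `((n - 1) (1 + β⁻¹) - (α⁻¹ - 1)) / ((m - 1) (1 + β⁻¹) + (α⁻¹ - 1))`, where the inverse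
of `+∞` is `0`. -/
def bound₃ (n m : ℕ) (α β : EReal) : EReal :=
  quot (((n : ℝ) - 1) * (1 + (β⁻¹).toReal) - ((α⁻¹).toReal - 1))
    (((m : ℝ) - 1) * (1 + (β⁻¹).toReal) + ((α⁻¹).toReal - 1))

end Diophantine

end

/-!
The pairs `(x, y)` near the kernel of `(x, y) ↦ Θ x - y` act as integer linear forms on the dual
lattice. In the coordinates `((ᵗΘ y' + x') / V, y' / Y)` such a form has coefficients at most
`A = max (V |x|) (Y |Θ x - y|)`. Let independent forms with bounds `A j` be given such that
`k! ∏ A j < V ^ m Y ^ n`. Complete them to a square system by the coordinates outside a minor of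
maximal absolute value. Minkowski's theorem then yields a nonzero integer point at which every
row of this system is less than `1`; the given forms take integer values, so they vanish there,
and Cramer's rule with the maximality of the minor bounds the remaining coordinates. The result is
an approximation to `ᵗΘ` with `|y'| ≪ Y` and error `≪ V`.

One form, from an approximation that realises `β(Θ)`, gives the first bound. For the other two a
second form comes from the uniform exponent, applied at a scale just below `|x|` for the second
bound and just below the error `|Θ x - y|` for the third. The first approximation may be taken
primitive, and the second is smaller, so the two are independent. If `Θ x ∈ ℤ ^ n` has
nontrivial solutions and their rank is not `1`, two independent exact solutions do the same.

All exponents are inverted, so that `+∞` becomes the ordinary value `0`.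
-/

open Filter Topology MeasureTheory

namespace Diophantine

section Minkowski

variable {ι : Type*} [Fintype ι]

theorem volume_preimage_pi_Ioo [DecidableEq ι] {M : Matrix ι ι ℝ} (h0 : M.det ≠ 0) :
    volume (M.toLin' ⁻¹' (Set.univ.pi fun _ => Set.Ioo (-1) 1)) =
      ENNReal.ofReal |M.det|⁻¹ * 2 ^ Fintype.card ι := by
  rw [Measure.addHaar_preimage_linearMap _ (by simpa using h0), volume_pi, Measure.pi_pi]
  simp only [LinearMap.det_toLin', Real.volume_Ioo, Finset.prod_const, Finset.card_univ, abs_inv]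
  norm_num

theorem volume_fundamentalDomain_basisFun :
    volume (ZSpan.fundamentalDomain (Pi.basisFun ℝ ι)) = 1 := by
  simp [ZSpan.fundamentalDomain_pi_basisFun, Real.volume_pi_Ico]

theorem exists_int_forall_abs_mulVec_lt_one [DecidableEq ι] {M : Matrix ι ι ℝ}
    (h0 : M.det ≠ 0) (h1 : |M.det| < 1) :
    ∃ w : ι → ℤ, w ≠ 0 ∧ ∀ i, |M.mulVec (fun j => (w j : ℝ)) i| < 1 := by
  set s : Set (ι → ℝ) := M.toLin' ⁻¹' (Set.univ.pi fun _ => Set.Ioo (-1) 1) with hs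
  have mem_s (x : ι → ℝ) : x ∈ s ↔ ∀ i, |M.mulVec x i| < 1 := by simp [hs, abs_lt, Set.mem_pi]
  have : Countable (Submodule.span ℤ (Set.range (Pi.basisFun ℝ ι))).toAddSubgroup :=
    inferInstanceAs (Countable (Submodule.span ℤ (Set.range (Pi.basisFun ℝ ι))))
  obtain ⟨⟨x, hx⟩, hx0, hxs⟩ := exists_ne_zero_mem_lattice_of_measure_mul_two_pow_lt_measure
    (s := s) (ZSpan.isAddFundamentalDomain' (Pi.basisFun ℝ ι) volume)
    (fun x hx => by rw [mem_s] at *; simpa [Matrix.mulVec_neg] using hx)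
    ((convex_pi fun _ _ => convex_Ioo _ _).linear_preimage _)
    (by
      rw [volume_fundamentalDomain_basisFun, volume_preimage_pi_Ioo h0,
        Module.finrank_fintype_fun_eq_card]
      gcongr
      · exact ENNReal.pow_ne_top ENNReal.ofNat_ne_top
      · exact ENNReal.one_lt_ofReal.2 ((one_lt_inv₀ (abs_pos.2 h0)).2 h1))
  have exists_int (i : ι) : ∃ z : ℤ, (z : ℝ) = x i := by
    simpa using ((Pi.basisFun ℝ ι).mem_span_iff_repr_mem ℤ x).1 hx i
  choose w hw using exists_int
  obtain rfl : (fun i => (w i : ℝ)) = x := funext hw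
  refine ⟨w, ?_, (mem_s _).1 hxs⟩
  rintro rfl
  exact hx0 (Subtype.ext (funext fun _ => Int.cast_zero))

end Minkowski

section Minors

variable {κ ι R : Type*}

/-- The square matrix whose row `f j` is the row `j` of `C`, and whose rows outside the range of
`f` are those of the identity matrix. It completes a family of independent linear forms by
coordinate functions. -/
noncomputable def completeRows [DecidableEq ι] [Zero R] [One R] (C : Matrix κ ι R) (f : κ → ι) :
    Matrix ι ι R :=
  Matrix.of (Function.extend f C (1 : Matrix ι ι R))

theorem completeRows_apply_of_injective [DecidableEq ι] [Zero R] [One R] (C : Matrix κ ι R)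
    {f : κ → ι} (hf : f.Injective) (j : κ) : completeRows C f (f j) = C j :=
  hf.extend_apply C _ j

theorem completeRows_apply_of_notMem_range [DecidableEq ι] [Zero R] [One R] (C : Matrix κ ι R)
    {f : κ → ι} {i : ι} (hi : i ∉ Set.range f) : completeRows C f i = (1 : Matrix ι ι R) i :=
  Function.extend_apply' C _ i hi

theorem completeRows_mulVec_apply_of_injective [Fintype ι] [DecidableEq ι] [NonAssocSemiring R]
    (C : Matrix κ ι R) {f : κ → ι} (hf : f.Injective) (t : ι → R) (j : κ) :
    (completeRows C f).mulVec t (f j) = C.mulVec t j := by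
  rw [Matrix.mulVec, completeRows_apply_of_injective C hf, Matrix.mulVec]

theorem completeRows_mulVec_apply_of_notMem_range [Fintype ι] [DecidableEq ι] [NonAssocSemiring R]
    (C : Matrix κ ι R) {f : κ → ι} (t : ι → R) {i : ι} (hi : i ∉ Set.range f) :
    (completeRows C f).mulVec t i = t i := by
  rw [Matrix.mulVec, completeRows_apply_of_notMem_range C hi, ← Matrix.mulVec, Matrix.one_mulVec]

theorem det_completeRows [Fintype κ] [DecidableEq κ] [Fintype ι] [DecidableEq ι] [CommRing R]
    (C : Matrix κ ι R) {f : κ → ι} (hf : f.Injective) :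
    (completeRows C f).det = (C.submatrix id f).det := by
  set P : Matrix ι κ R := (1 : Matrix ι ι R).submatrix id f with hP
  set Q : Matrix κ ι R := (1 : Matrix ι ι R).submatrix f id with hQ
  have hN : completeRows C f = 1 + P * (C - Q) := by
    ext i l
    by_cases hi : i ∈ Set.range f
    · obtain ⟨j, rfl⟩ := hi
      rw [completeRows_apply_of_injective C hf]
      simp [hP, hQ, Matrix.mul_apply, Matrix.one_apply, hf.eq_iff]
    · have hij (j : κ) : i ≠ f j := fun h => hi ⟨j, h.symm⟩
      rw [completeRows_apply_of_notMem_range C hi]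
      simp [hP, Matrix.mul_apply, hij]
  have hCP : C * P = C.submatrix id f := by
    ext j l
    simp [hP, Matrix.mul_apply, Matrix.one_apply]
  have hQP : Q * P = 1 := by
    ext i j
    simp [hP, hQ, Matrix.mul_apply, Matrix.one_apply, hf.eq_iff]
  rw [hN, Matrix.det_one_add_mul_comm, Matrix.sub_mul, hCP, hQP, add_sub_cancel]

theorem injective_of_det_submatrix_ne_zero [Fintype κ] [DecidableEq κ] [CommRing R]
    {C : Matrix κ ι R} {f : κ → ι} (h : (C.submatrix id f).det ≠ 0) : f.Injective := by
  intro i j hij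
  by_contra hne
  exact h (Matrix.det_zero_of_column_eq hne fun k => by simp only [Matrix.submatrix_apply, hij])

theorem exists_det_submatrix_ne_zero [Fintype κ] [DecidableEq κ] [Finite ι] [Field R]
    {C : Matrix κ ι R} (hC : LinearIndependent R C.row) :
    ∃ f : κ → ι, (C.submatrix id f).det ≠ 0 := by
  have := Fintype.ofFinite ι
  obtain ⟨σ, a, ha, hspan, hli⟩ := exists_linearIndependent' R C.col
  have := Finite.of_injective a ha
  have := Fintype.ofFinite σ
  have hcard : Fintype.card κ = Fintype.card σ := by
    rw [← hC.rank_matrix, Matrix.rank_eq_finrank_span_cols, ← hspan, finrank_span_eq_card hli]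
  let e : κ ≃ σ := Fintype.equivOfCardEq hcard
  have hcol : LinearIndependent R (C.submatrix id (a ∘ e)).col := hli.comp e e.injective
  exact ⟨a ∘ e, ((Matrix.isUnit_iff_isUnit_det _).1
    (Matrix.linearIndependent_cols_iff_isUnit.1 hcol)).ne_zero⟩

theorem exists_maximal_minor [Fintype κ] [DecidableEq κ] [Finite ι] [Field R] [LinearOrder R]
    [IsStrictOrderedRing R] {C : Matrix κ ι R} (hC : LinearIndependent R C.row) :
    ∃ f : κ → ι, (C.submatrix id f).det ≠ 0 ∧
      ∀ g : κ → ι, |(C.submatrix id g).det| ≤ |(C.submatrix id f).det| := by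
  obtain ⟨f₀, hf₀⟩ := exists_det_submatrix_ne_zero hC
  have : Nonempty (κ → ι) := ⟨f₀⟩
  obtain ⟨f, hmax⟩ := Finite.exists_max fun f : κ → ι => |(C.submatrix id f).det|
  exact ⟨f, abs_pos.1 ((abs_pos.2 hf₀).trans_le (hmax f₀)), hmax⟩

theorem det_submatrix_mul_apply_eq_neg_sum [Fintype κ] [DecidableEq κ] [Fintype ι] [DecidableEq ι]
    [CommRing R] {C : Matrix κ ι R} {f : κ → ι} (hf : f.Injective) {t : ι → R}
    (ht : C.mulVec t = 0) (j : κ) :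
    (C.submatrix id f).det * t (f j) =
      -∑ i ∈ (Finset.univ.image f)ᶜ, t i * (C.submatrix id (Function.update f j i)).det := by
  have hsum : (C.submatrix id f).mulVec (t ∘ f) =
      -∑ i ∈ (Finset.univ.image f)ᶜ, t i • C.col i := by
    rw [eq_neg_iff_add_eq_zero, ← ht]
    ext l
    simp only [Pi.add_apply, Finset.sum_apply, Pi.smul_apply, Matrix.mulVec, dotProduct,
      Matrix.submatrix_apply, Function.comp_apply, id, Matrix.col_apply, smul_eq_mul]
    rw [← Finset.sum_add_sum_compl (Finset.univ.image f), Finset.sum_image hf.injOn]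
    simp only [mul_comm]
  have hupdate (i : ι) : (C.submatrix id f).updateCol j (C.col i) =
      C.submatrix id (Function.update f j i) := by
    ext l k
    by_cases h : k = j <;> simp [h]
  calc (C.submatrix id f).det * t (f j)
      = (C.submatrix id f).cramer ((C.submatrix id f).mulVec (t ∘ f)) j := by
        rw [Matrix.cramer_eq_adjugate_mulVec, Matrix.mulVec_mulVec, Matrix.adjugate_mul,
          Matrix.smul_mulVec, Matrix.one_mulVec]
        rfl
    _ = _ := by
        rw [hsum, map_neg, map_sum]
        simp only [map_smul, Pi.neg_apply, Finset.sum_apply, Pi.smul_apply, smul_eq_mul,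
          Matrix.cramer_apply, hupdate]

theorem abs_apply_le_sum_of_maximal_minor [Fintype κ] [DecidableEq κ] [Fintype ι]
    [DecidableEq ι] [CommRing R] [LinearOrder R] [IsStrictOrderedRing R] {C : Matrix κ ι R}
    {f : κ → ι} (h0 : (C.submatrix id f).det ≠ 0)
    (hmax : ∀ g : κ → ι, |(C.submatrix id g).det| ≤ |(C.submatrix id f).det|) {t : ι → R}
    (ht : C.mulVec t = 0) (j : κ) : |t (f j)| ≤ ∑ i ∈ (Finset.univ.image f)ᶜ, |t i| := by
  refine le_of_mul_le_mul_left ?_ (abs_pos.2 h0)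
  rw [← abs_mul, det_submatrix_mul_apply_eq_neg_sum (injective_of_det_submatrix_ne_zero h0) ht,
    abs_neg, Finset.mul_sum]
  refine (Finset.abs_sum_le_sum_abs _ _).trans (Finset.sum_le_sum fun i _ => ?_)
  rw [abs_mul, mul_comm]
  exact mul_le_mul_of_nonneg_right (hmax _) (abs_nonneg _)

theorem abs_det_le_of_forall_abs_le [Fintype κ] [DecidableEq κ] [CommRing R] [LinearOrder R]
    [IsStrictOrderedRing R] {M : Matrix κ κ R} {A : κ → R} (hM : ∀ i j, |M i j| ≤ A i) :
    |M.det| ≤ (Fintype.card κ).factorial * ∏ i, A i := by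
  rw [Matrix.det_apply]
  calc |∑ σ : Equiv.Perm κ, Equiv.Perm.sign σ • ∏ i, M (σ i) i|
      ≤ ∑ σ : Equiv.Perm κ, |∏ i, M (σ i) i| := by
        refine (Finset.abs_sum_le_sum_abs _ _).trans_eq (Finset.sum_congr rfl fun σ _ => ?_)
        rcases Int.units_eq_one_or (Equiv.Perm.sign σ) with h | h <;> simp [h]
    _ ≤ ∑ _σ : Equiv.Perm κ, ∏ i, A i := by
        refine Finset.sum_le_sum fun σ _ => ?_
        rw [Finset.abs_prod, ← Equiv.prod_comp σ A]
        exact Finset.prod_le_prod (fun _ _ => abs_nonneg _) fun i _ => hM (σ i) i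
    _ = (Fintype.card κ).factorial * ∏ i, A i := by
        rw [Finset.sum_const, Finset.card_univ, Fintype.card_perm, nsmul_eq_mul]

end Minors

section IntegralForms

variable {κ ι : Type*} [Fintype ι] {T : Matrix ι ι ℝ} {C : Matrix κ ι ℝ} {Z : Matrix κ ι ℤ}

theorem linearIndependent_row_of_mul_eq_map_intCast [Finite κ]
    (hZ : LinearIndependent ℤ Z.row) (hCT : C * T = Z.map (↑)) :
    LinearIndependent ℝ C.row := by
  have := Fintype.ofFinite κ
  have hZℝ : LinearIndependent ℝ (Z.map (Int.cast : ℤ → ℝ)).row :=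
    linearIndependent_algebraMap_comp_iff (S := ℝ) (v := Z.row).2 hZ
  rw [← Matrix.vecMul_injective_iff, ← hCT] at hZℝ
  rw [← Matrix.vecMul_injective_iff]
  intro v w h
  exact hZℝ (by simpa only [← Matrix.vecMul_vecMul] using congrArg (Matrix.vecMul · T) h)

theorem mulVec_mulVec_intCast_eq_zero (hCT : C * T = Z.map (↑)) {w : ι → ℤ}
    (h : ∀ j, |C.mulVec (T.mulVec fun i => (w i : ℝ)) j| < 1) :
    C.mulVec (T.mulVec fun i => (w i : ℝ)) = 0 := by
  ext j
  have hint : C.mulVec (T.mulVec fun i => (w i : ℝ)) j = (Z.mulVec w j : ℤ) := by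
    rw [Matrix.mulVec_mulVec, hCT]
    simp [Matrix.mulVec, dotProduct]
  have hlt : |((Z.mulVec w j : ℤ) : ℝ)| < 1 := hint ▸ h j
  have hzero : Z.mulVec w j = 0 := Int.abs_lt_one_iff.1 (mod_cast hlt)
  rw [hint, hzero, Int.cast_zero, Pi.zero_apply]

theorem exists_int_abs_mulVec_le_of_minors [Fintype κ] [DecidableEq κ] [DecidableEq ι]
    (hT : T.det ≠ 0) (hZ : LinearIndependent ℤ Z.row) (hCT : C * T = Z.map (↑)) {A : ℝ}
    (hA : ∀ f : κ → ι, |(C.submatrix id f).det| ≤ A) (hAT : A * |T.det| < 1) :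
    ∃ w : ι → ℤ, w ≠ 0 ∧ ∀ i, |T.mulVec (fun j => (w j : ℝ)) i| ≤ Fintype.card ι := by
  obtain ⟨f, hf, hmax⟩ :=
    exists_maximal_minor (linearIndependent_row_of_mul_eq_map_intCast hZ hCT)
  have hinj : f.Injective := injective_of_det_submatrix_ne_zero hf
  have hdet : (completeRows C f * T).det = (C.submatrix id f).det * T.det := by
    rw [Matrix.det_mul, det_completeRows C hinj]
  obtain ⟨w, hw, hlt⟩ := exists_int_forall_abs_mulVec_lt_one (hdet ▸ mul_ne_zero hf hT) (by
    rw [hdet, abs_mul]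
    exact (mul_le_mul_of_nonneg_right (hA f) (abs_nonneg _)).trans_lt hAT)
  set t := T.mulVec (fun j => (w j : ℝ)) with ht
  simp only [← Matrix.mulVec_mulVec, ← ht] at hlt
  have hoff (i : ι) (hi : i ∉ Set.range f) : |t i| ≤ 1 :=
    (completeRows_mulVec_apply_of_notMem_range C t hi ▸ hlt i).le
  have hCt : C.mulVec t = 0 := mulVec_mulVec_intCast_eq_zero hCT fun j =>
    completeRows_mulVec_apply_of_injective C hinj t j ▸ hlt (f j)
  refine ⟨w, hw, fun i => ?_⟩
  by_cases hi : i ∈ Set.range f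
  · obtain ⟨j, rfl⟩ := hi
    calc |t (f j)| ≤ ∑ i ∈ (Finset.univ.image f)ᶜ, |t i| :=
          abs_apply_le_sum_of_maximal_minor hf hmax hCt j
      _ ≤ (Finset.univ.image f)ᶜ.card • (1 : ℝ) :=
          Finset.sum_le_card_nsmul _ _ _ fun i hi => hoff i (by simpa using hi)
      _ ≤ Fintype.card ι := by
          rw [nsmul_one]
          exact_mod_cast Finset.card_le_univ _
  · exact (hoff i hi).trans (mod_cast Fintype.card_pos_iff.2 ⟨i⟩)

theorem exists_int_abs_mulVec_le [Fintype κ] [DecidableEq ι]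
    (hT : T.det ≠ 0) (hZ : LinearIndependent ℤ Z.row) (hCT : C * T = Z.map (↑)) {A : κ → ℝ}
    (hA : ∀ j i, |C j i| ≤ A j) (hAT : (Fintype.card κ).factorial * (∏ j, A j) * |T.det| < 1) :
    ∃ w : ι → ℤ, w ≠ 0 ∧ ∀ i, |T.mulVec (fun j => (w j : ℝ)) i| ≤ Fintype.card ι := by
  classical
  exact exists_int_abs_mulVec_le_of_minors hT hZ hCT
    (fun f => abs_det_le_of_forall_abs_le fun j k => hA j (f k)) hAT

end IntegralForms

section Approximations

variable {n m : ℕ} (Θ : Matrix (Fin n) (Fin m) ℝ)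

theorem norm_intCast {ι : Type*} [Fintype ι] (x : ι → ℤ) : ‖fun i => (x i : ℝ)‖ = ‖x‖ := rfl

theorem one_le_norm_of_ne_zero {ι : Type*} [Fintype ι] {x : ι → ℤ} (hx : x ≠ 0) : 1 ≤ ‖x‖ := by
  obtain ⟨i, hi⟩ := Function.ne_iff.1 hx
  calc (1 : ℝ) ≤ ‖x i‖ := by
        rw [Int.norm_eq_abs]
        exact_mod_cast Int.one_le_abs hi
    _ ≤ ‖x‖ := norm_le_pi_norm x i

/-- The map `(x, y) ↦ Θ x - y` as a homomorphism of abelian groups: it makes linear algebra over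
`ℤ` available for approximations. -/
noncomputable def errorHom : (Fin m → ℤ) × (Fin n → ℤ) →ₗ[ℤ] (Fin n → ℝ) :=
  (AddMonoidHom.mk' (fun p => errorVec Θ p.1 p.2) fun p q => by
    have h : (fun j => (((p + q).1 j : ℤ) : ℝ)) = (fun j => (p.1 j : ℝ)) + fun j => (q.1 j : ℝ) :=
      funext fun j => Int.cast_add _ _
    ext i
    simp only [errorVec, h, Matrix.mulVec_add, Pi.add_apply, Pi.sub_apply, Prod.snd_add,
      Int.cast_add]
    ring).toIntLinearMap

@[simp]
theorem errorHom_apply (p : (Fin m → ℤ) × (Fin n → ℤ)) :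
    errorHom Θ p = errorVec Θ p.1 p.2 := rfl

theorem norm_errorVec_zero_left (y : Fin n → ℤ) : ‖errorVec Θ 0 y‖ = ‖y‖ := by
  have h : (fun j => (((0 : Fin m → ℤ) j : ℤ) : ℝ)) = 0 := by ext j; simp
  rw [errorVec, h, Matrix.mulVec_zero, zero_sub, norm_neg, norm_intCast]

theorem fst_ne_zero_of_norm_errorVec_lt_one {p : (Fin m → ℤ) × (Fin n → ℤ)} (hp : p ≠ 0)
    (h : ‖errorVec Θ p.1 p.2‖ < 1) : p.1 ≠ 0 := by
  intro hp1
  rw [hp1, norm_errorVec_zero_left] at h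
  exact hp (Prod.ext hp1 (by_contra fun hp2 => (one_le_norm_of_ne_zero hp2).not_gt h))

end Approximations

section Transference

variable {κ : Type*} {n m : ℕ} (Θ : Matrix (Fin n) (Fin m) ℝ)

/-- The matrix of the linear map `(x', y') ↦ ((ᵗΘ y' + x') / V, y' / Y)`, whose values at integer
points measure approximations to `ᵗΘ` at the scales `V` for the error and `Y` for the size. -/
noncomputable def dualMatrix (V Y : ℝ) : Matrix (Fin m ⊕ Fin n) (Fin m ⊕ Fin n) ℝ :=
  Matrix.fromBlocks (V⁻¹ • 1) (V⁻¹ • Θ.transpose) 0 (Y⁻¹ • 1)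

/-- The matrix of the linear forms that correspond to integer pairs `(x, y)`, in the coordinates
given by `dualMatrix`. -/
noncomputable def dualForms (V Y : ℝ) (z : κ → (Fin m → ℤ) × (Fin n → ℤ)) :
    Matrix κ (Fin m ⊕ Fin n) ℝ :=
  Matrix.fromCols (Matrix.of fun j l => V * ((z j).1 l : ℝ))
    (Matrix.of fun j i => -(Y * errorVec Θ (z j).1 (z j).2 i))

/-- The matrix whose rows are the given integer pairs: it expresses `dualForms` in the standard
coordinates of `ℤ ^ m × ℤ ^ n`, where integrality and independence over `ℤ` are visible. -/
def pairMatrix (z : κ → (Fin m → ℤ) × (Fin n → ℤ)) : Matrix κ (Fin m ⊕ Fin n) ℤ :=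
  Matrix.of fun j => Sum.elim (z j).1 (z j).2

theorem det_dualMatrix (V Y : ℝ) : (dualMatrix Θ V Y).det = (V ^ m * Y ^ n)⁻¹ := by
  rw [dualMatrix, Matrix.det_fromBlocks_zero₂₁, Matrix.det_smul, Matrix.det_smul]
  simp [mul_comm]

theorem dualForms_mul_dualMatrix {V Y : ℝ} (hV : V ≠ 0) (hY : Y ≠ 0)
    (z : κ → (Fin m → ℤ) × (Fin n → ℤ)) :
    dualForms Θ V Y z * dualMatrix Θ V Y = (pairMatrix z).map (↑) := by
  rw [dualForms, dualMatrix, Matrix.fromCols_mul_fromBlocks]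
  ext j k
  rcases k with l | i
  · simp [pairMatrix, hV]
  · simp only [Matrix.mul_smul, Matrix.mul_one, Matrix.smul_of, errorVec, Pi.sub_apply,
      Matrix.mulVec, dotProduct, Matrix.mul_zero, add_zero, Matrix.fromCols_apply_inr,
      Matrix.add_apply, Matrix.smul_apply, Matrix.mul_apply, Matrix.of_apply,
      Matrix.transpose_apply, smul_eq_mul, Pi.smul_apply, mul_neg, pairMatrix, Matrix.map_apply,
      Sum.elim_inr]
    simp only [mul_assoc V, ← Finset.mul_sum, inv_mul_cancel_left₀ hV, inv_mul_cancel_left₀ hY,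
      mul_comm (Θ i _)]
    ring

theorem linearIndependent_pairMatrix_row {z : κ → (Fin m → ℤ) × (Fin n → ℤ)}
    (hz : LinearIndependent ℤ z) : LinearIndependent ℤ (pairMatrix z).row :=
  hz.map' (LinearEquiv.sumArrowLequivProdArrow (Fin m) (Fin n) ℤ ℤ).symm.toLinearMap
    (LinearEquiv.ker _)

theorem abs_dualForms_le {V Y A : ℝ} (hV : 0 < V) (hY : 0 < Y)
    {z : κ → (Fin m → ℤ) × (Fin n → ℤ)} {j : κ} (hx : V * ‖(z j).1‖ ≤ A)
    (hu : Y * ‖errorVec Θ (z j).1 (z j).2‖ ≤ A) (k : Fin m ⊕ Fin n) :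
    |dualForms Θ V Y z j k| ≤ A := by
  rcases k with l | i
  · calc |V * ((z j).1 l : ℝ)| = V * ‖(z j).1 l‖ := by
          rw [abs_mul, abs_of_pos hV, Int.norm_eq_abs]
      _ ≤ V * ‖(z j).1‖ := by gcongr; exact norm_le_pi_norm _ _
      _ ≤ A := hx
  · calc |-(Y * errorVec Θ (z j).1 (z j).2 i)| = Y * ‖errorVec Θ (z j).1 (z j).2 i‖ := by
          rw [abs_neg, abs_mul, abs_of_pos hY, Real.norm_eq_abs]
      _ ≤ Y * ‖errorVec Θ (z j).1 (z j).2‖ := by gcongr; exact norm_le_pi_norm _ _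
      _ ≤ A := hu

theorem norm_le_of_abs_dualMatrix_mulVec_le {V Y B : ℝ} (hV : 0 < V) (hY : 0 < Y) (hB : 0 ≤ B)
    {w : Fin m ⊕ Fin n → ℤ} (h : ∀ k, |(dualMatrix Θ V Y).mulVec (fun i => (w i : ℝ)) k| ≤ B) :
    ‖w ∘ Sum.inr‖ ≤ B * Y ∧ ‖errorVec Θ.transpose (w ∘ Sum.inr) (-(w ∘ Sum.inl))‖ ≤ B * V := by
  have hmul : (dualMatrix Θ V Y).mulVec (fun i => (w i : ℝ)) =
      Sum.elim (V⁻¹ • errorVec Θ.transpose (w ∘ Sum.inr) (-(w ∘ Sum.inl)))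
        (Y⁻¹ • fun i => ((w ∘ Sum.inr) i : ℝ)) := by
    rw [dualMatrix, Matrix.fromBlocks_mulVec]
    ext (l | i)
    · simp only [Function.comp_def, Matrix.smul_mulVec, Matrix.one_mulVec, Matrix.zero_mulVec,
        zero_add, Sum.elim_inl, Pi.add_apply, Pi.smul_apply, smul_eq_mul, errorVec, Pi.neg_apply,
        Int.cast_neg, Pi.sub_apply, sub_neg_eq_add]
      ring
    · simp [Matrix.smul_mulVec, Function.comp_def]
  rw [hmul] at h
  refine ⟨?_, ?_⟩
  · rw [← norm_intCast, pi_norm_le_iff_of_nonneg (by positivity)]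
    intro i
    have hi := h (Sum.inr i)
    rwa [Sum.elim_inr, Pi.smul_apply, smul_eq_mul, abs_mul, abs_of_pos (inv_pos.2 hY),
      inv_mul_le_iff₀ hY, mul_comm] at hi
  · rw [pi_norm_le_iff_of_nonneg (by positivity)]
    intro l
    have hl := h (Sum.inl l)
    rwa [Sum.elim_inl, Pi.smul_apply, smul_eq_mul, abs_mul, abs_of_pos (inv_pos.2 hV),
      inv_mul_le_iff₀ hV, mul_comm] at hl

theorem exists_transpose_approx [Fintype κ] {z : κ → (Fin m → ℤ) × (Fin n → ℤ)}
    (hz : LinearIndependent ℤ z) {V Y : ℝ} (hV : 0 < V) (hY : 0 < Y) {A : κ → ℝ}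
    (hx : ∀ j, V * ‖(z j).1‖ ≤ A j) (hu : ∀ j, Y * ‖errorVec Θ (z j).1 (z j).2‖ ≤ A j)
    (hA : (Fintype.card κ).factorial * ∏ j, A j < V ^ m * Y ^ n) :
    ∃ p : (Fin n → ℤ) × (Fin m → ℤ), p ≠ 0 ∧ ‖p.1‖ ≤ (m + n) * Y ∧
      ‖errorVec Θ.transpose p.1 p.2‖ ≤ (m + n) * V := by
  classical
  have hvol : 0 < V ^ m * Y ^ n := by positivity
  obtain ⟨w, hw, hle⟩ := exists_int_abs_mulVec_le
    (by rw [det_dualMatrix]; exact (inv_pos.2 hvol).ne')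
    (linearIndependent_pairMatrix_row hz) (dualForms_mul_dualMatrix Θ hV.ne' hY.ne' z)
    (fun j => abs_dualForms_le Θ hV hY (hx j) (hu j))
    (by rwa [det_dualMatrix, abs_inv, abs_of_pos hvol, ← div_eq_mul_inv, div_lt_one hvol])
  have hcard : (Fintype.card (Fin m ⊕ Fin n) : ℝ) = m + n := by simp
  rw [hcard] at hle
  refine ⟨(w ∘ Sum.inr, -(w ∘ Sum.inl)), fun h => hw ?_,
    norm_le_of_abs_dualMatrix_mulVec_le Θ hV hY (by positivity) hle⟩
  obtain ⟨hinr, hinl⟩ := Prod.ext_iff.1 h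
  ext (l | i)
  · exact congrFun (neg_eq_zero.1 hinl) l
  · exact congrFun hinr i

end Transference

section Unimodular

variable {R M E : Type*} [CommRing R] [AddCommGroup M] [Module R M]

/-- A vector on which some linear form takes the value `1`. Over `ℤ` these are the vectors with
coprime coordinates, and they are used to rule out that another vector is a rational multiple
without being an integer multiple. -/
def IsUnimodular (R : Type*) {M : Type*} [CommRing R] [AddCommGroup M] [Module R M] (z : M) :
    Prop :=
  ∃ φ : Module.Dual R M, φ z = 1

theorem exists_smul_isUnimodular [IsDomain R] [IsPrincipalIdealRing R] [Module.Free R M]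
    [Module.Finite R M] {z : M} (hz : z ≠ 0) :
    ∃ (g : R) (z' : M), g • z' = z ∧ IsUnimodular R z' := by
  obtain ⟨g, hg⟩ :=
    (IsPrincipalIdealRing.principal (LinearMap.range (Module.Dual.eval R M z))).principal
  have hdvd (φ : Module.Dual R M) : g ∣ φ z := by
    rw [← Ideal.mem_span_singleton, ← Ideal.submodule_span_eq, ← hg]
    exact ⟨φ, rfl⟩
  obtain ⟨φ, hφ⟩ : g ∈ LinearMap.range (Module.Dual.eval R M z) :=
    hg ▸ Submodule.mem_span_singleton_self g
  let b := Module.Free.chooseBasis R M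
  choose c hc using fun i => hdvd (b.coord i)
  have hgz : g • b.equivFun.symm c = z := by
    rw [← map_smul, LinearEquiv.symm_apply_eq]
    exact funext fun i => (hc i).symm
  have hg0 : g ≠ 0 := by
    rintro rfl
    exact hz (by rw [← hgz, zero_smul])
  refine ⟨g, _, hgz, φ, mul_left_cancel₀ hg0 ?_⟩
  rw [mul_one, ← smul_eq_mul, ← map_smul, hgz]
  exact hφ

theorem IsUnimodular.linearIndependent_pair [IsDomain R] [Module.IsTorsionFree R M] {z w : M}
    (hz : IsUnimodular R z) (hw : w ∉ Submodule.span R {z}) :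
    LinearIndependent R ![z, w] := by
  obtain ⟨φ, hφ⟩ := hz
  refine LinearIndependent.pair_iff.2 fun s t hst => ?_
  have hs : s = -(t * φ w) := by
    simpa [hφ, add_eq_zero_iff_eq_neg] using congrArg φ hst
  have htw : t • (w - φ w • z) = 0 := by
    rw [← hst, hs]
    module
  have ht : t = 0 := (smul_eq_zero.1 htw).resolve_right fun h =>
    hw (Submodule.mem_span_singleton.2 ⟨φ w, (sub_eq_zero.1 h).symm⟩)
  exact ⟨by rw [hs, ht, zero_mul, neg_zero], ht⟩

theorem norm_map_le_norm_map_zsmul [SeminormedAddCommGroup E] [NormSMulClass ℤ E]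
    (f : M →ₗ[ℤ] E) {k : ℤ} (hk : k ≠ 0) (z : M) : ‖f z‖ ≤ ‖f (k • z)‖ := by
  rw [map_smul, norm_smul, Int.norm_eq_abs]
  exact le_mul_of_one_le_left (norm_nonneg _) (by exact_mod_cast Int.one_le_abs hk)

theorem IsUnimodular.linearIndependent_pair_of_norm_lt [Module.IsTorsionFree ℤ M]
    [SeminormedAddCommGroup E] [NormSMulClass ℤ E] (f : M →ₗ[ℤ] E) {z w : M}
    (hz : IsUnimodular ℤ z) (hw : w ≠ 0) (h : ‖f w‖ < ‖f z‖) : LinearIndependent ℤ ![z, w] := by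
  refine hz.linearIndependent_pair fun hmem => ?_
  obtain ⟨k, rfl⟩ := Submodule.mem_span_singleton.1 hmem
  exact h.not_ge (norm_map_le_norm_map_zsmul f (left_ne_zero_of_smul hw) z)

end Unimodular

section Exponents

variable {n m : ℕ} (Θ : Matrix (Fin n) (Fin m) ℝ)

theorem finite_setOf_norm_fst_le (R : ℝ) :
    {p : (Fin m → ℤ) × (Fin n → ℤ) | ‖p.1‖ ≤ R ∧ ‖errorVec Θ p.1 p.2‖ ≤ 1}.Finite := by
  have hball (k : ℕ) (r : ℝ) : {x : Fin k → ℤ | ‖x‖ ≤ r}.Finite := by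
    have := (isCompact_closedBall (0 : Fin k → ℤ) r).finite_of_discrete
    exact this.subset fun x hx => mem_closedBall_zero_iff.2 hx
  refine ((hball m R).biUnion fun x _ => ((hball n
    (‖Θ.mulVec fun j => (x j : ℝ)‖ + 1)).image fun y => (x, y))).subset ?_
  rintro ⟨x, y⟩ ⟨hx, hy⟩
  simp only [Set.mem_iUnion, Set.mem_image]
  refine ⟨x, hx, y, ?_, rfl⟩
  calc ‖y‖ = ‖(Θ.mulVec fun j => (x j : ℝ)) - errorVec Θ x y‖ := by
        rw [errorVec, sub_sub_cancel, norm_intCast]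
    _ ≤ ‖Θ.mulVec fun j => (x j : ℝ)‖ + 1 := (norm_sub_le _ _).trans (by gcongr)

theorem exists_pos_forall_le_of_finite {α : Type*} {s : Set α} (hs : s.Finite) {f : α → ℝ}
    (hf : ∀ a ∈ s, 0 < f a) : ∃ ε > 0, ∀ a ∈ s, ε ≤ f a := by
  have h : ∀ᶠ ε in 𝓝[>] (0 : ℝ), ∀ a ∈ s, ε ≤ f a :=
    (eventually_all_finite hs).2 fun a ha => nhdsWithin_le_nhds (ge_mem_nhds (hf a ha))
  obtain ⟨ε, hε, hε0⟩ := (h.and self_mem_nhdsWithin).exists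
  exact ⟨ε, hε0, hε⟩

variable {Θ} in
theorem norm_errorVec_pos (hΘ : ∀ x ∈ exactSolutions Θ, x = 0) {x : Fin m → ℤ} (hx : x ≠ 0)
    (y : Fin n → ℤ) : 0 < ‖errorVec Θ x y‖ :=
  norm_pos_iff.2 fun h => hx (hΘ x ⟨y, h⟩)

variable {Θ} in
theorem exists_pos_forall_lt_norm_fst (hΘ : ∀ x ∈ exactSolutions Θ, x = 0) (R : ℝ) :
    ∃ ε > 0, ∀ p : (Fin m → ℤ) × (Fin n → ℤ), p.1 ≠ 0 → ‖errorVec Θ p.1 p.2‖ < ε →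
      R < ‖p.1‖ := by
  obtain ⟨ε, hε, h⟩ := exists_pos_forall_le_of_finite
    ((finite_setOf_norm_fst_le Θ R).inter_of_right {p | p.1 ≠ 0})
    (fun p hp => norm_errorVec_pos hΘ hp.1 p.2)
  refine ⟨min ε 1, lt_min hε one_pos, fun p hp hlt => ?_⟩
  by_contra! hR
  exact (hlt.trans_le (min_le_left _ _)).not_ge
    (h p ⟨hp, hR, (hlt.trans_le (min_le_right _ _)).le⟩)

theorem le_individualExponent_of_forall_exists {γ : ℝ}
    (h : ∀ ε > 0, ∃ p : (Fin m → ℤ) × (Fin n → ℤ), p.1 ≠ 0 ∧ ‖errorVec Θ p.1 p.2‖ < ε ∧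
      ‖errorVec Θ p.1 p.2‖ ≤ ‖p.1‖ ^ (-γ)) :
    (γ : EReal) ≤ individualExponent Θ := by
  refine le_sSup ⟨γ, rfl, ?_⟩
  by_cases hΘ : ∀ x ∈ exactSolutions Θ, x = 0
  · intro hfin
    obtain ⟨ε, hε, hle⟩ := exists_pos_forall_le_of_finite hfin
      (fun p hp => norm_errorVec_pos hΘ hp.1 p.2)
    obtain ⟨p, hp, hlt, hpγ⟩ := h ε hε
    exact hlt.not_ge (hle p ⟨hp, hpγ⟩)
  · push Not at hΘ
    obtain ⟨x, ⟨y, hxy⟩, hx⟩ := hΘ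
    have hp : ((x, y) : (Fin m → ℤ) × (Fin n → ℤ)) ≠ 0 := fun h0 => hx (congrArg Prod.fst h0)
    refine ((Set.Ioi_infinite (0 : ℤ)).image (smul_left_injective ℤ hp).injOn).mono ?_
    rintro _ ⟨k, hk, rfl⟩
    have hkx : k • x ≠ 0 := smul_ne_zero (ne_of_gt hk) hx
    have herr : errorHom Θ (k • (x, y)) = 0 := by
      rw [map_smul, errorHom_apply, hxy, smul_zero]
    rw [errorHom_apply] at herr
    refine ⟨hkx, ?_⟩
    rw [herr, norm_zero]
    positivity

theorem exists_of_lt_individualExponent {γ : ℝ} (hγ0 : 0 < γ)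
    (hγ : (γ : EReal) < individualExponent Θ) (R : ℝ) :
    ∃ p : (Fin m → ℤ) × (Fin n → ℤ), p.1 ≠ 0 ∧ R < ‖p.1‖ ∧
      ‖errorVec Θ p.1 p.2‖ ≤ ‖p.1‖ ^ (-γ) := by
  obtain ⟨_, ⟨γ', rfl, hinf⟩, hlt⟩ := lt_sSup_iff.1 hγ
  have hlt' : γ < γ' := EReal.coe_lt_coe_iff.1 hlt
  obtain ⟨p, ⟨hp, hpγ⟩, hnot⟩ := (hinf.sdiff (finite_setOf_norm_fst_le Θ R)).nonempty
  have hp1 : 1 ≤ ‖p.1‖ := one_le_norm_of_ne_zero hp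
  have hle : ‖errorVec Θ p.1 p.2‖ ≤ ‖p.1‖ ^ (-γ) :=
    hpγ.trans (Real.rpow_le_rpow_of_exponent_le hp1 (by linarith))
  have hle1 : ‖p.1‖ ^ (-γ) ≤ 1 := Real.rpow_le_one_of_one_le_of_nonpos hp1 (by linarith)
  exact ⟨p, hp, not_le.1 fun hR => hnot ⟨hR, hle.trans hle1⟩, hle⟩

theorem exists_isUnimodular_of_lt_individualExponent (hΘ : ∀ x ∈ exactSolutions Θ, x = 0)
    {γ : ℝ} (hγ0 : 0 < γ) (hγ : (γ : EReal) < individualExponent Θ) (R : ℝ) :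
    ∃ p : (Fin m → ℤ) × (Fin n → ℤ), IsUnimodular ℤ p ∧ p.1 ≠ 0 ∧ R < ‖p.1‖ ∧
      ‖errorVec Θ p.1 p.2‖ ≤ ‖p.1‖ ^ (-γ) := by
  obtain ⟨ε, hε, hR⟩ := exists_pos_forall_lt_norm_fst hΘ R
  obtain ⟨T, hT⟩ := eventually_atTop.1
    ((tendsto_rpow_neg_atTop hγ0).eventually (gt_mem_nhds hε))
  obtain ⟨p, hp, hTp, hpγ⟩ := exists_of_lt_individualExponent Θ hγ0 hγ T
  obtain ⟨g, p', rfl, hp'⟩ :=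
    exists_smul_isUnimodular (R := ℤ) (z := p) fun h => hp (congrArg Prod.fst h)
  have hg : g ≠ 0 := left_ne_zero_of_smul hp
  have hp'0 : p'.1 ≠ 0 := fun h => hp (by rw [Prod.smul_fst, h, smul_zero])
  have herr : ‖errorVec Θ p'.1 p'.2‖ ≤ ‖(g • p').1‖ ^ (-γ) :=
    (norm_map_le_norm_map_zsmul (errorHom Θ) hg p').trans hpγ
  refine ⟨p', hp', hp'0, hR p' hp'0 (herr.trans_lt (hT _ hTp.le)), herr.trans ?_⟩
  exact Real.rpow_le_rpow_of_nonpos (norm_pos_iff.2 hp'0)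
    (norm_map_le_norm_map_zsmul (LinearMap.fst ℤ _ _) hg p') (by linarith)

theorem eventually_of_lt_uniformExponent {a : ℝ} (ha : (a : EReal) < uniformExponent Θ) :
    ∀ᶠ t : ℝ in atTop, ∃ p : (Fin m → ℤ) × (Fin n → ℤ), p.1 ≠ 0 ∧ ‖p.1‖ ≤ t ∧
      ‖errorVec Θ p.1 p.2‖ ≤ t ^ (-a) := by
  obtain ⟨_, ⟨a', rfl, hev⟩, hlt⟩ := lt_sSup_iff.1 ha
  have hlt' : a < a' := EReal.coe_lt_coe_iff.1 hlt
  filter_upwards [hev, eventually_ge_atTop 1] with t ⟨x, y, hx, hxt, hxy⟩ ht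
  exact ⟨(x, y), norm_pos_iff.1 hx, hxt,
    hxy.trans (Real.rpow_le_rpow_of_exponent_le ht (by linarith))⟩

variable {Θ} in
theorem uniformExponent_eq_top {x : Fin m → ℤ} (hx : x ∈ exactSolutions Θ) (hx0 : x ≠ 0) :
    uniformExponent Θ = ⊤ := by
  obtain ⟨y, hxy⟩ := hx
  rw [EReal.eq_top_iff_forall_lt]
  intro r
  refine (EReal.coe_lt_coe_iff.2 (lt_add_one r)).trans_le (le_sSup ⟨r + 1, rfl, ?_⟩)
  filter_upwards [eventually_ge_atTop ‖x‖] with t ht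
  refine ⟨x, y, norm_pos_iff.2 hx0, ht, ?_⟩
  rw [hxy, norm_zero]
  exact Real.rpow_nonneg ((norm_nonneg _).trans ht) _

theorem eq_zero_of_mem_exactSolutions (hΘ : uniformExponent Θ ≠ ⊤) :
    ∀ x ∈ exactSolutions Θ, x = 0 := fun _ hx =>
  by_contra fun hx0 => hΘ (uniformExponent_eq_top hx hx0)

theorem coe_le_uniformExponent {δ : ℝ} (hδ : 0 < δ) (hδm : δ * n < m) :
    (δ : EReal) ≤ uniformExponent Θ := by
  have hc : (0 : ℝ) < n + m := by nlinarith [n.cast_nonneg (α := ℝ)]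
  have hlim : Tendsto (fun t : ℝ => t ^ (m - δ * n) / (n + m : ℝ) ^ (n + m)) atTop atTop :=
    (tendsto_rpow_atTop (sub_pos.2 hδm)).atTop_div_const (by positivity)
  refine le_sSup ⟨δ, rfl, ?_⟩
  filter_upwards [eventually_gt_atTop 1, hlim.eventually_gt_atTop 1] with t ht hvol
  have ht0 : 0 < t := zero_lt_one.trans ht
  have hvol' : 1 < (t ^ (-δ) / (n + m)) ^ n * (t / (n + m)) ^ m := by
    refine hvol.trans_eq ?_
    rw [div_pow, div_pow, div_mul_div_comm, ← pow_add, ← Real.rpow_mul_natCast ht0.le,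
      ← Real.rpow_natCast t m, ← Real.rpow_add ht0]
    ring_nf
  obtain ⟨p, hp, hpt, hperr⟩ := exists_transpose_approx Θ.transpose (κ := Empty)
    (linearIndependent_empty_type (v := Empty.elim)) (V := t ^ (-δ) / (n + m))
    (Y := t / (n + m)) (A := Empty.elim) (by positivity) (by positivity) (fun j => j.elim)
    (fun j => j.elim) (by simpa using hvol')
  rw [mul_div_cancel₀ _ hc.ne'] at hpt hperr
  rw [Matrix.transpose_transpose] at hperr
  have herr1 : ‖errorVec Θ p.1 p.2‖ < 1 :=
    hperr.trans_lt (Real.rpow_lt_one_of_one_lt_of_neg ht (by linarith))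
  exact ⟨p.1, p.2, norm_pos_iff.2 (fst_ne_zero_of_norm_errorVec_lt_one Θ hp herr1), hpt, hperr⟩

theorem uniformExponent_pos (hm : 1 ≤ m) : 0 < uniformExponent Θ := by
  have hm' : (1 : ℝ) ≤ m := by exact_mod_cast hm
  have hpos : (0 : ℝ) < 1 / (n + 1) := by positivity
  refine (EReal.coe_pos.2 hpos).trans_le (coe_le_uniformExponent Θ hpos ?_)
  rw [one_div_mul_eq_div, div_lt_iff₀ (by positivity)]
  nlinarith

theorem uniformExponent_le_individualExponent (hm : 1 ≤ m) :
    uniformExponent Θ ≤ individualExponent Θ := by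
  refine le_of_forall_lt fun c hc => ?_
  obtain ⟨a, hca, ha⟩ :=
    EReal.lt_iff_exists_real_btwn.1 (max_lt hc (uniformExponent_pos Θ hm))
  have ha0 : 0 < a := EReal.coe_pos.1 ((le_max_right _ _).trans_lt hca)
  refine ((le_max_left _ _).trans_lt hca).trans_le
    (le_individualExponent_of_forall_exists Θ fun ε hε => ?_)
  obtain ⟨t, ⟨p, hp, hpt, hperr⟩, ht⟩ := ((eventually_of_lt_uniformExponent Θ ha).and
    ((tendsto_rpow_neg_atTop ha0).eventually (gt_mem_nhds hε))).exists
  exact ⟨p, hp, hperr.trans_lt ht,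
    hperr.trans (Real.rpow_le_rpow_of_nonpos (norm_pos_iff.2 hp) hpt (by linarith))⟩

theorem individualExponent_pos (hm : 1 ≤ m) : 0 < individualExponent Θ :=
  (uniformExponent_pos Θ hm).trans_le (uniformExponent_le_individualExponent Θ hm)

end Exponents

section TransferenceExponents

variable {n m : ℕ} (Θ : Matrix (Fin n) (Fin m) ℝ)

theorem le_individualExponent_of_frequently {C N D γ : ℝ} (hC : 0 < C) (hN : 0 < N) (hγ : 0 ≤ γ)
    (hlt : γ * D < N)
    (h : ∃ᶠ R : ℝ in atTop, ∃ p : (Fin m → ℤ) × (Fin n → ℤ), p ≠ 0 ∧ ‖p.1‖ ≤ C * R ^ D ∧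
      ‖errorVec Θ p.1 p.2‖ ≤ C * R ^ (-N)) :
    (γ : EReal) ≤ individualExponent Θ := by
  refine le_individualExponent_of_forall_exists Θ fun ε hε => ?_
  have hsmall : Tendsto (fun R : ℝ => C * R ^ (-N)) atTop (𝓝 0) := by
    simpa using (tendsto_rpow_neg_atTop hN).const_mul C
  have hratio : Tendsto (fun R : ℝ => C * C ^ γ * R ^ (-(N - γ * D))) atTop (𝓝 0) := by
    simpa using (tendsto_rpow_neg_atTop (sub_pos.2 hlt)).const_mul (C * C ^ γ)
  obtain ⟨R, ⟨p, hp, hpR, hperr⟩, hRε, hR1, hR0⟩ := (h.and_eventually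
    ((hsmall.eventually (gt_mem_nhds (lt_min hε one_pos))).and
      ((hratio.eventually (gt_mem_nhds one_pos)).and (eventually_gt_atTop 0)))).exists
  have hp0 : p.1 ≠ 0 := fst_ne_zero_of_norm_errorVec_lt_one Θ hp
    (hperr.trans_lt (hRε.trans_le (min_le_right _ _)))
  refine ⟨p, hp0, hperr.trans_lt (hRε.trans_le (min_le_left _ _)), ?_⟩
  have hY : 0 < C * R ^ D := by positivity
  have hprod : C * R ^ (-N) * (C * R ^ D) ^ γ = C * C ^ γ * R ^ (-(N - γ * D)) := by
    rw [Real.mul_rpow hC.le (by positivity), ← Real.rpow_mul hR0.le,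
      show -(N - γ * D) = -N + D * γ by ring, Real.rpow_add hR0]
    ring
  calc ‖errorVec Θ p.1 p.2‖ ≤ C * R ^ (-N) := hperr
    _ ≤ (C * R ^ D) ^ (-γ) := by
      rw [Real.rpow_neg hY.le, ← one_div, le_div_iff₀ (Real.rpow_pos_of_pos hY _), hprod]
      exact hR1.le
    _ ≤ ‖p.1‖ ^ (-γ) :=
      Real.rpow_le_rpow_of_nonpos (norm_pos_iff.2 hp0) hpR (neg_nonpos.2 hγ)

theorem factorial_mul_prod_rpow_lt {κ : Type*} [Fintype κ] {p : κ → ℝ} {s c K N D R : ℝ}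
    (hκ : Fintype.card κ < m + n) (hK1 : 1 ≤ K)
    (hK : (Fintype.card κ).factorial * c ^ Fintype.card κ < K) (hs : N + D = s)
    (hN : (m + n - Fintype.card κ) * N = n * s - ∑ j, p j) (hR : 0 < R) :
    (Fintype.card κ).factorial * ∏ j, K * R ^ (-N) * (c * R ^ p j) <
      (K * R ^ (-N)) ^ m * (K * R ^ D) ^ n := by
  -- The value of `N` balances the powers of `R`, so the constants alone decide.
  set k := Fintype.card κ
  obtain ⟨l, hl⟩ := Nat.exists_eq_add_of_lt hκ
  have hpow : (R ^ (-N)) ^ (l + 1) * (R ^ s) ^ n = R ^ ∑ j, p j := by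
    have hl' : ((l + 1 : ℕ) : ℝ) = m + n - k := by
      rw [eq_sub_iff_add_eq]
      exact_mod_cast (show l + 1 + k = m + n by omega)
    rw [← Real.rpow_mul_natCast hR.le, ← Real.rpow_mul_natCast hR.le, hl', ← Real.rpow_add hR]
    congr 1
    linarith
  calc k.factorial * ∏ j, K * R ^ (-N) * (c * R ^ p j)
      = (K * R ^ (-N)) ^ k * (k.factorial * c ^ k * R ^ ∑ j, p j) := by
        rw [Real.rpow_sum_of_pos hR]
        simp only [Finset.prod_mul_distrib, Finset.prod_const, Finset.card_univ, k]
        ring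
    _ < (K * R ^ (-N)) ^ k * (K ^ (l + 1) * R ^ ∑ j, p j) := by
        gcongr
        exact hK.trans_le (le_self_pow₀ hK1 l.succ_ne_zero)
    _ = (K * R ^ (-N)) ^ (m + n) * (R ^ s) ^ n := by
        rw [hl, ← hpow]
        ring
    _ = (K * R ^ (-N)) ^ m * (K * R ^ D) ^ n := by
        rw [show D = -N + s by linarith, Real.rpow_add hR]
        ring

theorem exists_transpose_approx_of_rpow {κ : Type*} [Fintype κ] {p : κ → ℝ} {s c K N D R : ℝ}
    (hκ : Fintype.card κ < m + n) (hK1 : 1 ≤ K)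
    (hK : (Fintype.card κ).factorial * c ^ Fintype.card κ < K) (hs : N + D = s)
    (hN : (m + n - Fintype.card κ) * N = n * s - ∑ j, p j) (hR : 0 < R)
    {z : κ → (Fin m → ℤ) × (Fin n → ℤ)} (hz : LinearIndependent ℤ z)
    (hx : ∀ j, ‖(z j).1‖ ≤ c * R ^ p j)
    (hu : ∀ j, ‖errorVec Θ (z j).1 (z j).2‖ ≤ c * R ^ (p j - s)) :
    ∃ q : (Fin n → ℤ) × (Fin m → ℤ), q ≠ 0 ∧ ‖q.1‖ ≤ (m + n) * (K * R ^ D) ∧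
      ‖errorVec Θ.transpose q.1 q.2‖ ≤ (m + n) * (K * R ^ (-N)) := by
  refine exists_transpose_approx Θ hz (by positivity) (by positivity)
    (A := fun j => K * R ^ (-N) * (c * R ^ p j))
    (fun j => by gcongr; exact hx j) (fun j => ?_) (factorial_mul_prod_rpow_lt hκ hK1 hK hs hN hR)
  calc K * R ^ D * ‖errorVec Θ (z j).1 (z j).2‖ ≤ K * R ^ D * (c * R ^ (p j - s)) := by
        gcongr
        exact hu j
    _ = K * R ^ (-N) * (c * R ^ p j) := by
        have hexp : R ^ D * R ^ (p j - s) = R ^ (-N) * R ^ p j := by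
          rw [← Real.rpow_add hR, ← Real.rpow_add hR]
          congr 1
          linarith
        linear_combination K * c * hexp

theorem le_individualExponent_transpose_of_frequently {κ : Type*} [Fintype κ] {p : κ → ℝ}
    {s c γ : ℝ} (hκ : Fintype.card κ < m + n) (hc : 0 < c) (hs : 0 < s) (hγ : 0 ≤ γ)
    (hlt : γ * ((m - Fintype.card κ) * s + ∑ j, p j) < n * s - ∑ j, p j)
    (h : ∃ᶠ R : ℝ in atTop, ∃ z : κ → (Fin m → ℤ) × (Fin n → ℤ), LinearIndependent ℤ z ∧
      ∀ j, ‖(z j).1‖ ≤ c * R ^ p j ∧ ‖errorVec Θ (z j).1 (z j).2‖ ≤ c * R ^ (p j - s)) :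
    (γ : EReal) ≤ individualExponent Θ.transpose := by
  set k := Fintype.card κ
  have hκ' : (k : ℝ) < m + n := by exact_mod_cast hκ
  have hd : 0 < (m + n - k : ℝ) := sub_pos.2 hκ'
  set N : ℝ := n * s - ∑ j, p j
  set D : ℝ := (m - k) * s + ∑ j, p j
  have hND : N + D = (m + n - k) * s := by ring
  have hN : 0 < N := by
    by_contra! hN
    have hD : 0 ≤ D := by linarith [mul_pos hd hs]
    linarith [mul_nonneg hγ hD]
  set K : ℝ := k.factorial * c ^ k + 1
  have hC : (0 : ℝ) < (m + n) * K := mul_pos (hκ'.trans_le' k.cast_nonneg) (by positivity)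
  refine le_individualExponent_of_frequently Θ.transpose hC (N := N / (m + n - k))
    (D := D / (m + n - k)) (div_pos hN hd) hγ ?_ ?_
  · rw [← mul_div_assoc]
    gcongr
  · refine (h.and_eventually (eventually_gt_atTop 0)).mono ?_
    rintro R ⟨⟨z, hz, hzR⟩, hR⟩
    simp only [mul_assoc]
    exact exists_transpose_approx_of_rpow Θ hκ (le_add_of_nonneg_left (by positivity))
      (lt_add_one _) (by rw [← add_div, hND, mul_div_cancel_left₀ _ hd.ne'])
      (mul_div_cancel₀ _ hd.ne') hR hz (fun j => (hzR j).1) (fun j => (hzR j).2)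

theorem le_individualExponent_transpose_of_lt_individualExponent {b γ : ℝ} (hmn : 1 < m + n)
    (hb0 : 0 < b) (hb : ((b⁻¹ : ℝ) : EReal) < individualExponent Θ) (hγ : 0 ≤ γ)
    (hlt : γ * ((m - 1) + m * b) < n + (n - 1) * b) :
    (γ : EReal) ≤ individualExponent Θ.transpose := by
  refine le_individualExponent_transpose_of_frequently Θ (κ := Unit) (p := fun _ => b)
    (s := 1 + b) (c := 1) (by simpa using hmn) one_pos (by positivity) hγ
    (by simp only [Fintype.card_unit, Nat.cast_one, Finset.univ_unique, Finset.sum_const,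
          Finset.card_singleton, one_smul]
        linarith)
    (frequently_atTop.2 fun R₀ => ?_)
  obtain ⟨T, hT⟩ := eventually_atTop.1
    ((tendsto_rpow_atTop (inv_pos.2 hb0)).eventually_ge_atTop R₀)
  obtain ⟨p, hp, hTp, hperr⟩ := exists_of_lt_individualExponent Θ (inv_pos.2 hb0) hb T
  refine ⟨‖p.1‖ ^ b⁻¹, hT _ hTp.le, fun _ => p,
    LinearIndependent.of_subsingleton () fun h => hp (congrArg Prod.fst h), fun _ => ⟨?_, ?_⟩⟩
  · rw [one_mul, Real.rpow_inv_rpow (norm_nonneg _) hb0.ne']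
  · rwa [one_mul, sub_add_cancel_right, Real.rpow_neg_one, ← Real.rpow_neg (norm_nonneg _)]

theorem le_individualExponent_transpose_of_pair {b e c γ : ℝ} (hmn : 2 < m + n) (hb0 : 0 ≤ b)
    (hc : 0 < c) (hγ : 0 ≤ γ)
    (hlt : γ * ((m - 1) * (1 + b) + (e - 1)) < (n - 1) * (1 + b) - (e - 1))
    (h : ∃ᶠ R : ℝ in atTop, ∃ z w : (Fin m → ℤ) × (Fin n → ℤ), LinearIndependent ℤ ![z, w] ∧
      ‖z.1‖ ≤ c * R ^ b ∧ ‖errorVec Θ z.1 z.2‖ ≤ c * R ^ (-1 : ℝ) ∧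
      ‖w.1‖ ≤ c * R ^ e ∧ ‖errorVec Θ w.1 w.2‖ ≤ c * R ^ (e - (1 + b))) :
    (γ : EReal) ≤ individualExponent Θ.transpose := by
  refine le_individualExponent_transpose_of_frequently Θ (κ := Fin 2) (p := ![b, e])
    (s := 1 + b) (by simpa using hmn) hc (by positivity) hγ
    (by simp only [Fintype.card_fin, Nat.cast_ofNat, Fin.sum_univ_two, Matrix.cons_val_zero,
          Matrix.cons_val_one]
        linarith)
    (h.mono ?_)
  rintro R ⟨z, w, hzw, hz, hzerr, hw, hwerr⟩
  refine ⟨![z, w], hzw, Fin.forall_fin_two.2 ⟨⟨hz, ?_⟩, hw, hwerr⟩⟩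
  simpa only [Matrix.cons_val_zero, sub_add_cancel_right] using hzerr

variable {Θ} in
theorem exists_linearIndependent_pair_norm_fst_le_half {a g : ℝ}
    (hΘ : ∀ x ∈ exactSolutions Θ, x = 0) (ha : (a : EReal) < uniformExponent Θ) (hg0 : 0 < g)
    (hg : (g : EReal) < individualExponent Θ) (T : ℝ) :
    ∃ z w : (Fin m → ℤ) × (Fin n → ℤ), LinearIndependent ℤ ![z, w] ∧ T < ‖z.1‖ ∧
      ‖errorVec Θ z.1 z.2‖ ≤ ‖z.1‖ ^ (-g) ∧ ‖w.1‖ ≤ ‖z.1‖ / 2 ∧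
      ‖errorVec Θ w.1 w.2‖ ≤ (‖z.1‖ / 2) ^ (-a) := by
  have hhalf : Tendsto (fun t : ℝ => t / 2) atTop atTop := tendsto_id.atTop_div_const two_pos
  obtain ⟨T', hT'⟩ := eventually_atTop.1 (hhalf.eventually (eventually_of_lt_uniformExponent Θ ha))
  obtain ⟨z, hz, hz0, hTz, hzerr⟩ :=
    exists_isUnimodular_of_lt_individualExponent Θ hΘ hg0 hg (max T T')
  obtain ⟨w, hw0, hwt, hwerr⟩ := hT' _ ((le_max_right _ _).trans hTz.le)
  exact ⟨z, w, hz.linearIndependent_pair_of_norm_lt (LinearMap.fst ℤ _ _)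
    (fun h => hw0 (congrArg Prod.fst h)) (hwt.trans_lt (half_lt_self (norm_pos_iff.2 hz0))),
    (le_max_left _ _).trans_lt hTz, hzerr, hwt, hwerr⟩

variable {Θ} in
theorem exists_linearIndependent_pair_norm_errorVec_le_half {a g : ℝ}
    (hΘ : ∀ x ∈ exactSolutions Θ, x = 0) (ha0 : 0 < a)
    (ha : ((a⁻¹ : ℝ) : EReal) < uniformExponent Θ) (hg0 : 0 < g)
    (hg : (g : EReal) < individualExponent Θ) (T : ℝ) :
    ∃ z w : (Fin m → ℤ) × (Fin n → ℤ), ∃ R > 0, LinearIndependent ℤ ![z, w] ∧ T < ‖z.1‖ ∧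
      ‖errorVec Θ z.1 z.2‖ = R⁻¹ ∧ ‖z.1‖ ^ g ≤ R ∧ ‖w.1‖ ≤ (2 * R) ^ a ∧
      ‖errorVec Θ w.1 w.2‖ ≤ R⁻¹ / 2 := by
  have hscale : Tendsto (fun R : ℝ => (2 * R) ^ a) atTop atTop :=
    (tendsto_rpow_atTop ha0).comp (tendsto_id.const_mul_atTop two_pos)
  obtain ⟨T₁, hT₁⟩ := eventually_atTop.1
    (hscale.eventually (eventually_of_lt_uniformExponent Θ ha))
  obtain ⟨T₂, hT₂⟩ := eventually_atTop.1 ((tendsto_rpow_atTop hg0).eventually_ge_atTop T₁)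
  obtain ⟨z, hz, hz0, hTz, hzerr⟩ :=
    exists_isUnimodular_of_lt_individualExponent Θ hΘ hg0 hg (max T T₂)
  obtain ⟨R, hUR⟩ : ∃ R : ℝ, ‖errorVec Θ z.1 z.2‖ = R⁻¹ := ⟨_, (inv_inv _).symm⟩
  have hR0 : 0 < R := inv_pos.1 (hUR ▸ norm_errorVec_pos hΘ hz0 z.2)
  have hzR : ‖z.1‖ ^ g ≤ R := by
    rwa [hUR, Real.rpow_neg (norm_nonneg _),
      inv_le_inv₀ hR0 (Real.rpow_pos_of_pos (norm_pos_iff.2 hz0) _)] at hzerr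
  obtain ⟨w, hw0, hwt, hwerr⟩ := hT₁ R ((hT₂ _ ((le_max_right _ _).trans hTz.le)).trans hzR)
  have hwU : ‖errorVec Θ w.1 w.2‖ ≤ R⁻¹ / 2 := by
    refine hwerr.trans_eq ?_
    rw [← Real.rpow_mul (by positivity), mul_neg, mul_inv_cancel₀ ha0.ne', Real.rpow_neg_one,
      mul_inv, div_eq_inv_mul]
  exact ⟨z, w, R, hR0, hz.linearIndependent_pair_of_norm_lt (errorHom Θ)
    (fun h => hw0 (congrArg Prod.fst h))
    (hwU.trans_lt (by rw [errorHom_apply, hUR]; exact half_lt_self (inv_pos.2 hR0))),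
    (le_max_left _ _).trans_lt hTz, hUR, hzR, hwt, hwU⟩

variable {Θ} in
theorem le_individualExponent_transpose_of_scale_fst {a b γ : ℝ} (hmn : 2 < m + n)
    (hΘ : ∀ x ∈ exactSolutions Θ, x = 0) (hb0 : 0 < b) (hba : b ≤ a)
    (ha : ((a⁻¹ : ℝ) : EReal) < uniformExponent Θ)
    (hb : ((b⁻¹ : ℝ) : EReal) < individualExponent Θ) (hγ : 0 ≤ γ)
    (hlt : γ * ((m - 1) * (1 + b) + b * (1 - a⁻¹)) < (n - 1) * (1 + b) - b * (1 - a⁻¹)) :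
    (γ : EReal) ≤ individualExponent Θ.transpose := by
  have ha0 : 0 < a := hb0.trans_le hba
  have hc : (1 : ℝ) ≤ 2 ^ a⁻¹ := Real.one_le_rpow one_le_two (inv_nonneg.2 ha0.le)
  refine le_individualExponent_transpose_of_pair Θ (b := b) (e := 1 + b * (1 - a⁻¹))
    (c := 2 ^ a⁻¹) hmn hb0.le (by positivity) hγ (by simpa using hlt)
    (frequently_atTop.2 fun R₀ => ?_)
  obtain ⟨T, hT⟩ := eventually_atTop.1
    ((tendsto_rpow_atTop (inv_pos.2 hb0)).eventually_ge_atTop (max R₀ 1))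
  obtain ⟨z, w, hzw, hTz, hzerr, hwt, hwerr⟩ :=
    exists_linearIndependent_pair_norm_fst_le_half hΘ ha (inv_pos.2 hb0) hb T
  have hR := hT _ hTz.le
  set R : ℝ := ‖z.1‖ ^ b⁻¹
  have hR1 : 1 ≤ R := (le_max_right _ _).trans hR
  have hR0 : 0 < R := zero_lt_one.trans_le hR1
  have hzR : ‖z.1‖ = R ^ b := (Real.rpow_inv_rpow (norm_nonneg _) hb0.ne').symm
  refine ⟨R, (le_max_left _ _).trans hR, z, w, hzw, ?_, ?_, ?_, ?_⟩
  · exact hzR ▸ le_mul_of_one_le_left (norm_nonneg _) hc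
  · rw [Real.rpow_neg_one, ← Real.rpow_neg (norm_nonneg _)]
    exact hzerr.trans (le_mul_of_one_le_left (by positivity) hc)
  · calc ‖w.1‖ ≤ R ^ b := hzR ▸ hwt.trans (half_le_self (norm_nonneg _))
      _ ≤ R ^ (1 + b * (1 - a⁻¹)) := by
        refine Real.rpow_le_rpow_of_exponent_le hR1 ?_
        have : b * a⁻¹ ≤ 1 := by rwa [← div_eq_mul_inv, div_le_one ha0]
        linarith
      _ ≤ 2 ^ a⁻¹ * R ^ (1 + b * (1 - a⁻¹)) := le_mul_of_one_le_left (by positivity) hc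
  · calc ‖errorVec Θ w.1 w.2‖ ≤ (R ^ b / 2) ^ (-a⁻¹) := hzR ▸ hwerr
      _ = 2 ^ a⁻¹ * R ^ (1 + b * (1 - a⁻¹) - (1 + b)) := by
        rw [Real.div_rpow (by positivity) zero_le_two, ← Real.rpow_mul hR0.le,
          Real.rpow_neg zero_le_two, div_inv_eq_mul, mul_comm]
        ring_nf

variable {Θ} in
theorem le_individualExponent_transpose_of_scale_errorVec {a b γ : ℝ} (hmn : 2 < m + n)
    (hΘ : ∀ x ∈ exactSolutions Θ, x = 0) (hb0 : 0 < b) (hba : b ≤ a)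
    (ha : ((a⁻¹ : ℝ) : EReal) < uniformExponent Θ)
    (hb : ((b⁻¹ : ℝ) : EReal) < individualExponent Θ) (hγ : 0 ≤ γ)
    (hlt : γ * ((m - 1) * (1 + b) + (a - 1)) < (n - 1) * (1 + b) - (a - 1)) :
    (γ : EReal) ≤ individualExponent Θ.transpose := by
  have ha0 : 0 < a := hb0.trans_le hba
  have hc : (1 : ℝ) ≤ 2 ^ a := Real.one_le_rpow one_le_two ha0.le
  refine le_individualExponent_transpose_of_pair Θ (c := 2 ^ a) hmn hb0.le (by positivity) hγ hlt
    (frequently_atTop.2 fun R₀ => ?_)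
  obtain ⟨T, hT⟩ := eventually_atTop.1
    ((tendsto_rpow_atTop (inv_pos.2 hb0)).eventually_ge_atTop (max R₀ 1))
  obtain ⟨z, w, R, hR0, hzw, hTz, hzerr, hzR, hwt, hwerr⟩ :=
    exists_linearIndependent_pair_norm_errorVec_le_half hΘ ha0 ha (inv_pos.2 hb0) hb T
  have hR : max R₀ 1 ≤ R := (hT _ hTz.le).trans hzR
  refine ⟨R, (le_max_left _ _).trans hR, z, w, hzw, ?_, ?_, ?_, ?_⟩
  · calc ‖z.1‖ = (‖z.1‖ ^ b⁻¹) ^ b := (Real.rpow_inv_rpow (norm_nonneg _) hb0.ne').symm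
      _ ≤ R ^ b := by gcongr
      _ ≤ 2 ^ a * R ^ b := le_mul_of_one_le_left (by positivity) hc
  · rw [hzerr, Real.rpow_neg_one]
    exact le_mul_of_one_le_left (by positivity) hc
  · rwa [Real.mul_rpow zero_le_two hR0.le] at hwt
  · calc ‖errorVec Θ w.1 w.2‖ ≤ R⁻¹ := hwerr.trans (half_le_self (by positivity))
      _ = R ^ (-1 : ℝ) := (Real.rpow_neg_one R).symm
      _ ≤ R ^ (a - (1 + b)) :=
        Real.rpow_le_rpow_of_exponent_le ((le_max_right _ _).trans hR) (by linarith)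
      _ ≤ 2 ^ a * R ^ (a - (1 + b)) := le_mul_of_one_le_left (by positivity) hc

theorem exists_linearIndependent_pair_errorVec_eq_zero
    (hrank : Set.finrank ℤ (exactSolutions Θ) ≠ 1) {x : Fin m → ℤ} (hx : x ∈ exactSolutions Θ)
    (hx0 : x ≠ 0) :
    ∃ z w : (Fin m → ℤ) × (Fin n → ℤ), LinearIndependent ℤ ![z, w] ∧
      errorVec Θ z.1 z.2 = 0 ∧ errorVec Θ w.1 w.2 = 0 := by
  set L := (LinearMap.ker (errorHom Θ)).map (LinearMap.fst ℤ (Fin m → ℤ) (Fin n → ℤ))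
  have hL (x : Fin m → ℤ) : x ∈ L ↔ x ∈ exactSolutions Θ := by
    simp [L, exactSolutions, Submodule.mem_map]
  have hxL : x ∈ L := (hL x).2 hx
  have hx' : (⟨x, hxL⟩ : L) ≠ 0 := fun h => hx0 (congrArg Subtype.val h)
  have hpos : 0 < Module.finrank ℤ L :=
    have : Nontrivial L := ⟨⟨_, _, hx'⟩⟩
    Module.finrank_pos
  rw [← Set.ext hL, Set.finrank, Submodule.span_eq] at hrank
  obtain ⟨⟨x', hx'L⟩, hxx'⟩ := exists_linearIndependent_pair_of_one_lt_finrank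
    (by omega : 1 < Module.finrank ℤ L) hx'
  obtain ⟨y, hy⟩ := hx
  obtain ⟨y', hy'⟩ := (hL x').1 hx'L
  have hfst : L.subtype ∘ ![⟨x, hxL⟩, ⟨x', hx'L⟩] =
      LinearMap.fst ℤ _ (Fin n → ℤ) ∘ ![(x, y), (x', y')] :=
    funext (Fin.forall_fin_two.2 ⟨rfl, rfl⟩)
  exact ⟨(x, y), (x', y'), .of_comp (LinearMap.fst ℤ _ _)
    (hfst ▸ hxx'.map' L.subtype L.ker_subtype), hy, hy'⟩

theorem le_individualExponent_transpose_of_finrank_ne_one {γ : ℝ} (hmn : 2 < m + n)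
    (hrank : Set.finrank ℤ (exactSolutions Θ) ≠ 1) {x : Fin m → ℤ} (hx : x ∈ exactSolutions Θ)
    (hx0 : x ≠ 0) (hγ : 0 ≤ γ) (hlt : γ * (m - 2) < n) :
    (γ : EReal) ≤ individualExponent Θ.transpose := by
  obtain ⟨z, w, hzw, hz, hw⟩ := exists_linearIndependent_pair_errorVec_eq_zero Θ hrank hx hx0
  refine le_individualExponent_transpose_of_pair Θ (b := 0) (e := 0) (c := ‖z.1‖ + ‖w.1‖ + 1)
    hmn le_rfl (by positivity) hγ (by linarith) (Eventually.frequently ?_)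
  filter_upwards [eventually_gt_atTop 0] with R hR
  refine ⟨z, w, hzw, ?_, ?_, ?_, ?_⟩
  · rw [Real.rpow_zero]
    linarith [norm_nonneg w.1]
  · rw [hz, norm_zero]
    positivity
  · rw [Real.rpow_zero]
    linarith [norm_nonneg z.1]
  · rw [hw, norm_zero]
    positivity

end TransferenceExponents

section Bounds

theorem inv_toReal_nonneg {x : EReal} (hx : 0 < x) : 0 ≤ (x⁻¹).toReal :=
  EReal.toReal_nonneg (EReal.inv_nonneg_of_nonneg hx.le)

theorem inv_toReal_anti {x y : EReal} (hx : 0 < x) (hxy : x ≤ y) :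
    (y⁻¹).toReal ≤ (x⁻¹).toReal :=
  EReal.toReal_le_toReal (EReal.inv_strictAntiOn.antitoneOn hx (hx.trans_le hxy) hxy)
    (EReal.bot_lt_zero.trans_le (EReal.inv_nonneg_of_nonneg (hx.trans_le hxy).le)).ne'
    (EReal.inv_lt_top _).ne

theorem inv_inv_toReal_add_lt {x : EReal} (hx : 0 < x) {δ : ℝ} (hδ : 0 < δ) :
    ((((x⁻¹).toReal + δ)⁻¹ : ℝ) : EReal) < x := by
  induction x with
  | bot => exact absurd hx not_lt_bot
  | top => exact EReal.coe_lt_top _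
  | coe x =>
    rw [← EReal.coe_inv, EReal.toReal_coe, EReal.coe_lt_coe_iff]
    exact inv_lt_of_inv_lt₀ (EReal.coe_pos.1 hx) (lt_add_of_pos_right _ hδ)

theorem quot_le_of_forall_le {N D : ℝ} {β : EReal} (hβ : 0 ≤ β) (hND : 0 < N + D)
    (h : ∀ γ : ℝ, 0 ≤ γ → γ * D < N → (γ : EReal) ≤ β) : quot N D ≤ β := by
  refine EReal.ge_of_forall_gt_iff_ge.1 fun γ hγ => ?_
  rcases lt_or_ge γ 0 with hγ0 | hγ0
  · exact (EReal.coe_neg'.2 hγ0).le.trans hβ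
  refine h γ hγ0 ?_
  unfold quot at hγ
  split_ifs at hγ with hD
  · rw [hD, mul_zero]
    linarith
  · have hlt : γ < N / D := EReal.coe_lt_coe_iff.1 hγ
    rcases div_pos_iff.1 (hγ0.trans_lt hlt) with ⟨-, hD⟩ | ⟨hN, hD⟩
    · exact (lt_div_iff₀ hD).1 hlt
    · linarith

theorem quot_le_of_continuousAt {N D : ℝ → ℝ} {β : EReal} (hN : ContinuousAt N 0)
    (hD : ContinuousAt D 0) (hβ : 0 ≤ β) (hND : 0 < N 0 + D 0)
    (h : ∀ δ > 0, ∀ γ : ℝ, 0 ≤ γ → γ * D δ < N δ → (γ : EReal) ≤ β) :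
    quot (N 0) (D 0) ≤ β := by
  refine quot_le_of_forall_le hβ hND fun γ hγ hlt => ?_
  have hev : ∀ᶠ δ in 𝓝[>] (0 : ℝ), γ * D δ < N δ :=
    nhdsWithin_le_nhds ((hD.const_mul γ).eventually_lt hN hlt)
  obtain ⟨δ, hδ, hδ0⟩ := (hev.and self_mem_nhdsWithin).exists
  exact h δ hδ0 γ hγ hδ

theorem quot_mul_left {c : ℝ} (hc : c ≠ 0) (p q : ℝ) : quot (c * p) (c * q) = quot p q := by
  simp only [quot, mul_eq_zero, hc, false_or, mul_div_mul_left p q hc]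

theorem bound₁_eq (n m : ℕ) {β : EReal} (hβ : 0 < β) :
    bound₁ n m β = quot (n + (n - 1) * (β⁻¹).toReal) ((m - 1) + m * (β⁻¹).toReal) := by
  induction β with
  | bot => exact absurd hβ not_lt_bot
  | top => simp [bound₁]
  | coe b =>
    have hb : b ≠ 0 := (EReal.coe_pos.1 hβ).ne'
    rw [bound₁, if_neg (EReal.coe_ne_top b), ← EReal.coe_inv, EReal.toReal_coe, EReal.toReal_coe,
      ← quot_mul_left hb (n + (n - 1) * b⁻¹)]
    congr 1 <;> field_simp
    ring

theorem bound₂_eq (n m : ℕ) (a : ℝ) {β : EReal} (hβ : 0 < β) :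
    bound₂ n m a β =
      quot ((n - 1) * (1 + (β⁻¹).toReal) - (β⁻¹).toReal * (1 - a))
        ((m - 1) * (1 + (β⁻¹).toReal) + (β⁻¹).toReal * (1 - a)) := by
  induction β with
  | bot => exact absurd hβ not_lt_bot
  | top => simp [bound₂]
  | coe b =>
    have hb : b ≠ 0 := (EReal.coe_pos.1 hβ).ne'
    rw [bound₂, if_neg (EReal.coe_ne_top b), ← EReal.coe_inv, EReal.toReal_coe, EReal.toReal_coe,
      ← quot_mul_left hb ((n - 1) * (1 + b⁻¹) - b⁻¹ * (1 - a))]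
    congr 1 <;> field_simp <;> ring

variable {n m : ℕ} (Θ : Matrix (Fin n) (Fin m) ℝ)

theorem bound₁_le (hn : 1 ≤ n) (hm : 1 ≤ m) :
    bound₁ n m (individualExponent Θ) ≤ individualExponent Θ.transpose := by
  have hmn : (2 : ℝ) ≤ m + n := by exact_mod_cast (show 2 ≤ m + n by omega)
  have hβ := individualExponent_pos Θ hm
  have hb0 := inv_toReal_nonneg hβ
  rw [bound₁_eq n m hβ]
  set b := ((individualExponent Θ)⁻¹).toReal
  have key := quot_le_of_continuousAt (N := fun δ => n + (n - 1) * (b + δ))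
    (D := fun δ => (m - 1) + m * (b + δ)) (by fun_prop) (by fun_prop)
    (individualExponent_pos Θ.transpose hn).le (by nlinarith) fun δ hδ γ hγ hlt =>
      le_individualExponent_transpose_of_lt_individualExponent Θ (by omega)
        (add_pos_of_nonneg_of_pos hb0 hδ) (inv_inv_toReal_add_lt hβ hδ) hγ hlt
  simpa only [add_zero] using key

theorem bound₂_le (hn : 1 ≤ n) (hm : 1 ≤ m) (hmn : 2 < m + n) {a : ℝ}
    (ha : uniformExponent Θ = a) :
    bound₂ n m a (individualExponent Θ) ≤ individualExponent Θ.transpose := by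
  have hmn' : (3 : ℝ) ≤ m + n := by exact_mod_cast hmn
  have hα := uniformExponent_pos Θ hm
  have hβ := individualExponent_pos Θ hm
  have hΘ := eq_zero_of_mem_exactSolutions Θ (ha ▸ EReal.coe_ne_top a)
  have ha0 : a ≠ 0 := (EReal.coe_pos.1 (ha ▸ hα)).ne'
  have hinv : ((uniformExponent Θ)⁻¹).toReal = a⁻¹ := by
    rw [ha, ← EReal.coe_inv, EReal.toReal_coe]
  have hb0 := inv_toReal_nonneg hβ
  have hba := inv_toReal_anti hα (uniformExponent_le_individualExponent Θ hm)
  have hlt_α {δ : ℝ} (hδ : 0 < δ) := inv_inv_toReal_add_lt hα hδ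
  rw [hinv] at hba hlt_α
  rw [bound₂_eq n m a hβ]
  set b := ((individualExponent Θ)⁻¹).toReal
  have hcont : ContinuousAt (fun δ : ℝ => (a⁻¹ + δ)⁻¹) 0 :=
    ContinuousAt.inv₀ (by fun_prop) (by simpa using ha0)
  have key := quot_le_of_continuousAt
    (N := fun δ => (n - 1) * (1 + (b + δ)) - (b + δ) * (1 - (a⁻¹ + δ)⁻¹))
    (D := fun δ => (m - 1) * (1 + (b + δ)) + (b + δ) * (1 - (a⁻¹ + δ)⁻¹))
    (by fun_prop) (by fun_prop) (individualExponent_pos Θ.transpose hn).le (by nlinarith)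
    fun δ hδ γ hγ hlt => le_individualExponent_transpose_of_scale_fst hmn hΘ
      (add_pos_of_nonneg_of_pos hb0 hδ) (by gcongr) (hlt_α hδ) (inv_inv_toReal_add_lt hβ hδ) hγ hlt
  simpa only [add_zero, inv_inv] using key

theorem bound₃_le_of_exactSolutions_eq_zero (hn : 1 ≤ n) (hm : 1 ≤ m) (hmn : 2 < m + n)
    (hΘ : ∀ x ∈ exactSolutions Θ, x = 0) :
    bound₃ n m (uniformExponent Θ) (individualExponent Θ) ≤ individualExponent Θ.transpose := by
  have hmn' : (3 : ℝ) ≤ m + n := by exact_mod_cast hmn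
  have hα := uniformExponent_pos Θ hm
  have hβ := individualExponent_pos Θ hm
  have hb0 := inv_toReal_nonneg hβ
  have hba := inv_toReal_anti hα (uniformExponent_le_individualExponent Θ hm)
  rw [bound₃]
  set a := ((uniformExponent Θ)⁻¹).toReal
  set b := ((individualExponent Θ)⁻¹).toReal
  have key := quot_le_of_continuousAt (N := fun δ => (n - 1) * (1 + (b + δ)) - (a + δ - 1))
    (D := fun δ => (m - 1) * (1 + (b + δ)) + (a + δ - 1)) (by fun_prop) (by fun_prop)
    (individualExponent_pos Θ.transpose hn).le (by nlinarith) fun δ hδ γ hγ hlt =>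
      le_individualExponent_transpose_of_scale_errorVec hmn hΘ (add_pos_of_nonneg_of_pos hb0 hδ)
        (by gcongr) (inv_inv_toReal_add_lt hα hδ) (inv_inv_toReal_add_lt hβ hδ) hγ hlt
  simpa only [add_zero] using key

theorem bound₃_le (hn : 1 ≤ n) (hm : 1 ≤ m) (hmn : 2 < m + n)
    (hrank : Set.finrank ℤ (exactSolutions Θ) ≠ 1) :
    bound₃ n m (uniformExponent Θ) (individualExponent Θ) ≤ individualExponent Θ.transpose := by
  by_cases hΘ : ∀ x ∈ exactSolutions Θ, x = 0
  · exact bound₃_le_of_exactSolutions_eq_zero Θ hn hm hmn hΘ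
  push Not at hΘ
  obtain ⟨x, hx, hx0⟩ := hΘ
  have hmn' : (3 : ℝ) ≤ m + n := by exact_mod_cast hmn
  have hα : uniformExponent Θ = ⊤ := uniformExponent_eq_top hx hx0
  have hβ : individualExponent Θ = ⊤ :=
    top_le_iff.1 (hα ▸ uniformExponent_le_individualExponent Θ hm)
  rw [bound₃, hα, hβ, EReal.inv_top, EReal.toReal_zero]
  exact quot_le_of_forall_le (individualExponent_pos Θ.transpose hn).le (by linarith)
    fun γ hγ hlt => le_individualExponent_transpose_of_finrank_ne_one Θ hmn hrank hx hx0 hγ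
      (by linarith)

end Bounds

end Diophantine

theorem theorem4 (n m : ℕ) (hn : 1 ≤ n) (hm : 1 ≤ m) (hnm : ¬ (n = 1 ∧ m = 1))
    (Θ : Matrix (Fin n) (Fin m) ℝ) :
    Diophantine.bound₁ n m (Diophantine.individualExponent Θ)
        ≤ Diophantine.individualExponent Θ.transpose ∧
    (∀ a : ℝ, Diophantine.uniformExponent Θ = (a : EReal) →
      Diophantine.bound₂ n m a (Diophantine.individualExponent Θ)
        ≤ Diophantine.individualExponent Θ.transpose) ∧
    (Set.finrank ℤ (Diophantine.exactSolutions Θ) ≠ 1 →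
      Diophantine.bound₃ n m (Diophantine.uniformExponent Θ) (Diophantine.individualExponent Θ)
        ≤ Diophantine.individualExponent Θ.transpose) := by
  have hmn : 2 < m + n := by omega
  exact ⟨Diophantine.bound₁_le Θ hn hm, fun _ ha => Diophantine.bound₂_le Θ hn hm hmn ha,
    Diophantine.bound₃_le Θ hn hm hmn⟩
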